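/- **Theorem.** For a bounded operator $T$ on a complex normed space $X$, put $\mathbb{C}\text{-}\mathrm{Orb}(T)=\{\lambda T^n:\lambda\in\mathbb{C},\,n\ge 0\}$ and, for $x\in X$, $\mathbb{C}\text{-}\mathrm{Orb}(T,x)=\{\lambda T^n x:\lambda\in\mathbb{C},\,n\ge 0\}$. Let $\mathbb{C}\text{-}\mathrm{OrbRef}(T)$ be the set of all bounded operators $S$ on $X$ such that $Sx$ lies in the norm closure of $\mathbb{C}\text{-}\mathrm{Orb}(T,x)$ for every $x\in X$. The operator $T$ is called *$\mathbb{C}$-orbit reflexive* if $\mathbb{C}\text{-}\mathrm{OrbRef}(T)$ is the closure of $\mathbb{C}\text{-}\mathrm{Orb}(T)$ in the strong operator topology. Let $T$ be a complex $d\times d$ matrix, regarded as an operator on the Euclidean space $\mathbb{C}^d$, and suppose that $T$ is not nilpotent. Let $r(T)=\max\{|\lambda|:\lambda\in\sigma(T)\}$ be its spectral radius. Then $r(T)>0$, $T$ has a Jordan form, and for every Jordan form of $T$ the following are equivalent: 1. $T$ is $\mathbb{C}$-orbit reflexive; 2. among all the Jordan blocks whose eigenvalue has modulus equal to $r(T)$,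 the two largest blocks differ in size by at most $1$. (Blocks are counted with multiplicity, so the two largest blocks may have the same size and may belong to the same eigenvalue or to different eigenvalues. If there is only one block with eigenvalue of modulus $r(T)$, the size of the missing second block is taken to be $0$, so that the condition says that this single block has size $1$.) -/

import Mathlib

noncomputable section

namespace COrbit

/-! ### Orbits and orbit reflexivity of an operator on a complex normed space -/

section Operators

variable {X : Type*} [NormedAddCommGroup X] [NormedSpace ℂ X]

/-- `ℂ-Orb(T) = {λ Tⁿ : n ≥ 0, λ ∈ ℂ}`, a set of bounded operators. -/
def orb (T : X →L[ℂ] X) : Set (X →L[ℂ] X) :=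
  {S | ∃ (c : ℂ) (n : ℕ), S = c • T ^ n}

/-- `ℂ-Orb(T, x) = {λ Tⁿ x : n ≥ 0, λ ∈ ℂ}`, a set of vectors. -/
def orbAt (T : X →L[ℂ] X) (x : X) : Set X :=
  {y | ∃ (c : ℂ) (n : ℕ), y = c • (T ^ n) x}

/-- `ℂ-OrbRef(T)`: the operators `S` such that `S x` lies in the (norm) closure of
`ℂ-Orb(T, x)` for every `x`. -/
def orbRef (T : X →L[ℂ] X) : Set (X →L[ℂ] X) :=
  {S | ∀ x : X, S x ∈ closure (orbAt T x)}

/-- The closure of a set of bounded operators in the strong operator topology, which is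
the topology of pointwise convergence carried by the type synonym `X →Lₚₜ[ℂ] X`. -/
def sotClosure (A : Set (X →L[ℂ] X)) : Set (X →L[ℂ] X) :=
  {S | ContinuousLinearMap.toPointwiseConvergenceCLM ℂ (RingHom.id ℂ) X X S ∈
    closure (ContinuousLinearMap.toPointwiseConvergenceCLM ℂ (RingHom.id ℂ) X X '' A)}

/-- `T` is `ℂ`-orbit reflexive: `ℂ-OrbRef(T)` is the strong operator closure of
`ℂ-Orb(T)`. -/
def IsOrbitReflexive (T : X →L[ℂ] X) : Prop :=
  orbRef T = sotClosure (orb T)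

end Operators

/-! ### Jordan forms of complex matrices -/

/-- The `m × m` Jordan block with eigenvalue `μ`: `μ` on the diagonal, `1` on the
subdiagonal and `0` elsewhere. -/
def jordanBlock (μ : ℂ) (m : ℕ) : Matrix (Fin m) (Fin m) ℂ :=
  Matrix.of fun i j =>
    if i = j then μ else if (i : ℕ) = (j : ℕ) + 1 then 1 else 0

/-- A finite list of Jordan blocks, each given by its eigenvalue and its size. -/
structure JordanBlocks where
  numBlocks : ℕ
  eigenvalue : Fin numBlocks → ℂ
  size : Fin numBlocks → ℕ
  size_pos : ∀ i, 0 < size i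

/-- The block diagonal matrix whose diagonal blocks are the given Jordan blocks. -/
def JordanBlocks.toMatrix (J : JordanBlocks) :
    Matrix (Σ i, Fin (J.size i)) (Σ i, Fin (J.size i)) ℂ :=
  Matrix.blockDiagonal' fun i => jordanBlock (J.eigenvalue i) (J.size i)

/-- `J` is a Jordan form of `T`: after numbering the index set of the block diagonal matrix
of `J` by `Fin d`, that matrix is similar to `T`. -/
def IsJordanForm {d : ℕ} (T : Matrix (Fin d) (Fin d) ℂ) (J : JordanBlocks) : Prop :=
  ∃ (e : Fin d ≃ Σ i, Fin (J.size i)) (P : GL (Fin d) ℂ),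
    T = (P : Matrix (Fin d) (Fin d) ℂ) * J.toMatrix.submatrix e e *
      ((P⁻¹ : GL (Fin d) ℂ) : Matrix (Fin d) (Fin d) ℂ)

open scoped Classical in
/-- The (indices of the) Jordan blocks whose eigenvalue has modulus `r`. -/
def JordanBlocks.ofModulus (J : JordanBlocks) (r : ENNReal) : Finset (Fin J.numBlocks) :=
  Finset.univ.filter fun i => ‖J.eigenvalue i‖ₑ = r

/-- Among the Jordan blocks with eigenvalues of modulus `r`, the two largest blocks differ in
size by at most `1`: for a block `i` of largest size, the largest size occurring among the
remaining blocks is at least `size i - 1`. The size of a missing second block is `0`, the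
supremum of the empty set. -/
def JordanBlocks.TwoLargestDifferByAtMostOne (J : JordanBlocks) (r : ENNReal) : Prop :=
  ∃ i ∈ J.ofModulus r, (∀ j ∈ J.ofModulus r, J.size j ≤ J.size i) ∧
    J.size i ≤ ((J.ofModulus r).erase i).sup J.size + 1

end COrbit

end

/-!
In a Jordan basis the `k`-th coordinate of `T ^ n x` along a chain with eigenvalue `μ` is
`∑ q ≤ k, (n choose q) * μ ^ (n - q) * x_(k - q)`, of order at most `n ^ k * |μ| ^ n`. So if `p + 1`
is the largest size of a block with `|μ| = r(T)`, the orbit of a generic `x` is of order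
`n ^ p * r(T) ^ n`. This order is attained only by the coordinates of index `p` along the blocks of
modulus `r(T)`, and there its coefficient depends only on the first coordinate of `x`.

Let `S` belong to `ℂ-OrbRef(T)` but not to `ℂ-Orb(T)`. By Baire's theorem a generic `x` satisfies
`c k • T ^ (n k) x → S x` with `n k → ∞`, so `S` has values in the span of the last vectors of the
largest chains. If a second block has size at least `p`, comparing growth along the two blocks
shows that the coordinate of `S z` along the last vector of a largest chain vanishes whenever the
first coordinate of `z` does. Then the scalars `c k` obtained from one generic `x` satisfy
`c k • T ^ (n k) → S` strongly.

If instead all other blocks of modulus `r(T)` are shorter by at least `2`, the rank one operator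
`z ↦ z_1 • e`, with `e` the last vector of the largest chain and `z_1` the second coordinate of `z`
along it, belongs to `ℂ-OrbRef(T)`: the orbit of `z` approaches the line `ℂ e` as soon as `z_1 ≠ 0`.
It does not commute with `T`, so it is not in the strong closure of `ℂ-Orb(T)`.
-/

namespace COrbit

open Asymptotics Filter Polynomial Topology
open Finset.HasAntidiagonal (antidiagonal mem_antidiagonal)

section JordanBasis

variable {R V ι : Type*} [CommRing R] [AddCommGroup V] [Module R V] {s : ι → ℕ}
  {f : Module.End R V} {μ : ι → R} {b : Module.Basis (Σ i, Fin (s i)) R V}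

/-- `c` is a Jordan chain of `f` for the eigenvalue `μ`. Chains are numbered so that `f - μ` raises
the index, in accordance with the subdiagonal convention of `jordanBlock`; the eigenvector is the
last vector of the chain. -/
def IsJordanChain (f : Module.End R V) (μ : R) {m : ℕ} (c : Fin m → V) : Prop :=
  ∀ k : Fin m, f (c k) = μ • c k + if h : (k : ℕ) + 1 < m then c ⟨k + 1, h⟩ else 0

/-- `b` is a Jordan basis of `f`: for each `i`, the vectors `b ⟨i, 0⟩, b ⟨i, 1⟩, …` form a Jordan
chain for the eigenvalue `μ i`. -/
def IsJordanBasis (f : Module.End R V) (μ : ι → R) (b : Module.Basis (Σ i, Fin (s i)) R V) :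
    Prop :=
  ∀ i, IsJordanChain f (μ i) fun k => b ⟨i, k⟩

/-- The coordinate functional of `b` at position `k` of the chain `i`. The position is a natural
number, and positions beyond the end of the chain give the zero functional. -/
noncomputable def coord (b : Module.Basis (Σ i, Fin (s i)) R V) (i : ι) (k : ℕ) : V →ₗ[R] R :=
  if h : k < s i then b.coord ⟨i, ⟨k, h⟩⟩ else 0

theorem coord_fin (i : ι) (k : Fin (s i)) : coord b i k = b.coord ⟨i, k⟩ :=
  dif_pos k.is_lt

theorem coord_of_le {i : ι} {k : ℕ} (h : s i ≤ k) : coord b i k = 0 :=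
  dif_neg h.not_gt

open scoped Classical in
theorem coord_basis (i j : ι) (k : ℕ) (l : Fin (s j)) :
    coord b i k (b ⟨j, l⟩) = if j = i ∧ (l : ℕ) = k then 1 else 0 := by
  by_cases hk : k < s i
  · rw [show coord b i k = b.coord ⟨i, ⟨k, hk⟩⟩ from coord_fin i ⟨k, hk⟩, Module.Basis.coord_apply,
      Module.Basis.repr_self, Finsupp.single_apply]
    refine if_congr ⟨fun h => ?_, ?_⟩ rfl rfl
    · cases h
      exact ⟨rfl, rfl⟩
    · rintro ⟨rfl, rfl⟩
      rfl
  · rw [coord_of_le (not_lt.1 hk), LinearMap.zero_apply, if_neg]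
    rintro ⟨rfl, rfl⟩
    exact hk l.is_lt

theorem coord_basis_self (i : ι) (k : Fin (s i)) : coord b i k (b ⟨i, k⟩) = 1 := by
  simp [coord_basis]

theorem ext_coord {x y : V} (h : ∀ i, ∀ k < s i, coord b i k x = coord b i k y) : x = y :=
  b.ext_elem fun ⟨i, k⟩ => by simpa [coord_fin] using h i k k.is_lt

namespace IsJordanBasis

theorem coord_zero_apply (hf : IsJordanBasis f μ b) (i : ι) (x : V) :
    coord b i 0 (f x) = μ i * coord b i 0 x := by
  classical
  suffices coord b i 0 ∘ₗ f = μ i • coord b i 0 from LinearMap.congr_fun this x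
  refine b.ext fun ⟨j, l⟩ => ?_
  have hnext : coord b i 0 (if h : (l : ℕ) + 1 < s j then b ⟨j, ⟨l + 1, h⟩⟩ else 0) = 0 := by
    split_ifs <;> simp [coord_basis]
  rw [LinearMap.comp_apply, hf, map_add, map_smul, hnext, add_zero]
  by_cases h : j = i <;> simp_all [coord_basis]

theorem coord_succ_apply (hf : IsJordanBasis f μ b) {i : ι} {k : ℕ} (hk : k + 1 < s i) (x : V) :
    coord b i (k + 1) (f x) = μ i * coord b i (k + 1) x + coord b i k x := by
  classical
  suffices coord b i (k + 1) ∘ₗ f = μ i • coord b i (k + 1) + coord b i k from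
    LinearMap.congr_fun this x
  refine b.ext fun ⟨j, l⟩ => ?_
  have hnext : coord b i (k + 1) (if h : (l : ℕ) + 1 < s j then b ⟨j, ⟨l + 1, h⟩⟩ else 0) =
      coord b i k (b ⟨j, l⟩) := by
    split_ifs with h
    · simp [coord_basis]
    · rw [map_zero, coord_basis, if_neg]
      rintro ⟨rfl, rfl⟩
      exact h hk
  rw [LinearMap.comp_apply, hf, map_add, map_smul, hnext]
  by_cases h : j = i <;> simp_all [coord_basis]

theorem coord_zero_pow (hf : IsJordanBasis f μ b) (i : ι) (n : ℕ) (x : V) :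
    coord b i 0 ((f ^ n) x) = μ i ^ n * coord b i 0 x := by
  induction n with
  | zero => simp
  | succ n ih =>
    rw [pow_succ', Module.End.mul_apply, hf.coord_zero_apply, ih, pow_succ', mul_assoc]

end IsJordanBasis

/-- The coefficient of `N ^ q` in `(μ + N) ^ n`. For `n < q` it vanishes, because the binomial
coefficient does; the exponent `n - q` is then truncated. -/
def jordanPowCoeff (μ : R) (q n : ℕ) : R :=
  n.choose q * μ ^ (n - q)

theorem jordanPowCoeff_zero_succ (μ : R) (n : ℕ) :
    jordanPowCoeff μ 0 (n + 1) = μ * jordanPowCoeff μ 0 n := by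
  simp [jordanPowCoeff, pow_succ']

theorem jordanPowCoeff_succ_succ (μ : R) (q n : ℕ) :
    jordanPowCoeff μ (q + 1) (n + 1) =
      μ * jordanPowCoeff μ (q + 1) n + jordanPowCoeff μ q n := by
  unfold jordanPowCoeff
  rcases lt_or_ge q n with h | h
  · obtain ⟨m, rfl⟩ := Nat.exists_eq_add_of_lt h
    rw [Nat.choose_succ_succ, show q + m + 1 + 1 - (q + 1) = m + 1 by omega,
      show q + m + 1 - (q + 1) = m by omega, show q + m + 1 - q = m + 1 by omega]
    push_cast
    ring
  · rw [Nat.choose_succ_succ, Nat.choose_eq_zero_of_lt (Nat.lt_succ_of_le h),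
      Nat.add_sub_add_right]
    simp

theorem IsJordanBasis.coord_pow (hf : IsJordanBasis f μ b) {i : ι} {k : ℕ} (hk : k < s i) (n : ℕ)
    (x : V) : coord b i k ((f ^ n) x) =
      ∑ qm ∈ antidiagonal k, jordanPowCoeff (μ i) qm.1 n * coord b i qm.2 x := by
  induction n generalizing k with
  | zero =>
    rw [Finset.sum_eq_single (0, k)]
    · simp [jordanPowCoeff]
    · rintro ⟨q, m⟩ hqm hne
      have hq : q ≠ 0 := by
        rintro rfl
        simp_all
      simp [jordanPowCoeff, Nat.choose_eq_zero_of_lt (Nat.pos_of_ne_zero hq)]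
    · simp
  | succ n ih =>
    rw [pow_succ', Module.End.mul_apply]
    cases k with
    | zero => simp [hf.coord_zero_apply, ih hk, jordanPowCoeff_zero_succ, mul_assoc]
    | succ k =>
      rw [hf.coord_succ_apply hk, ih hk, ih (k.lt_succ_self.trans hk),
        Finset.Nat.antidiagonal_succ, Finset.sum_cons, Finset.sum_cons]
      simp [jordanPowCoeff_zero_succ, jordanPowCoeff_succ_succ, Finset.mul_sum, add_mul,
        Finset.sum_add_distrib, mul_add, mul_assoc, add_assoc]

namespace IsJordanBasis

theorem isNilpotent [Finite ι] (hf : IsJordanBasis f μ b) (hμ : ∀ i, μ i = 0) :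
    IsNilpotent f := by
  obtain ⟨n, hn⟩ := Finite.bddAbove_range s
  refine ⟨n, LinearMap.ext fun x => ext_coord (b := b) fun i k hk => ?_⟩
  rw [hf.coord_pow hk, LinearMap.zero_apply, map_zero]
  refine Finset.sum_eq_zero fun qm hqm => ?_
  have hqn : n - qm.1 ≠ 0 := by
    have := mem_antidiagonal.1 hqm
    have := hn ⟨i, rfl⟩
    omega
  rw [jordanPowCoeff, hμ, zero_pow hqn, mul_zero, zero_mul]

theorem apply_last (hf : IsJordanBasis f μ b) {i : ι} {k : Fin (s i)} (hk : s i ≤ k + 1) :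
    f (b ⟨i, k⟩) = μ i • b ⟨i, k⟩ := by
  rw [hf, dif_neg hk.not_gt, add_zero]

theorem hasEigenvalue_iff [IsDomain R] (hf : IsJordanBasis f μ b) (hs : ∀ i, 0 < s i) {z : R} :
    f.HasEigenvalue z ↔ ∃ i, μ i = z := by
  constructor
  · intro hz
    obtain ⟨x, hx⟩ := hz.exists_hasEigenvector
    by_contra! hne
    have hcancel {i : ι} {c : R} (h : z * c = μ i * c) : c = 0 :=
      by_contra fun hc => hne i (mul_right_cancel₀ hc h).symm
    refine hx.2 (ext_coord (b := b) fun i k => ?_)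
    rw [map_zero]
    induction k with
    | zero =>
      intro _
      have h := hf.coord_zero_apply i x
      rw [hx.apply_eq_smul, map_smul, smul_eq_mul] at h
      exact hcancel h
    | succ k ih =>
      intro hk
      have h := hf.coord_succ_apply hk x
      rw [hx.apply_eq_smul, map_smul, smul_eq_mul, ih (k.lt_succ_self.trans hk), add_zero] at h
      exact hcancel h
  · rintro ⟨i, rfl⟩
    let last : Fin (s i) := ⟨s i - 1, Nat.sub_lt (hs i) one_pos⟩
    exact Module.End.hasEigenvalue_of_hasEigenvector
      ⟨Module.End.mem_eigenspace_iff.2 (hf.apply_last (k := last) le_tsub_add),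
        b.ne_zero _⟩

end IsJordanBasis

end JordanBasis

section JordanBasisExistence

namespace IsJordanBasis

variable {R V W ι κ : Type*} [CommRing R] [AddCommGroup V] [Module R V] [AddCommGroup W]
  [Module R W] {s : ι → ℕ} {f : Module.End R V} {μ : ι → R}
  {b : Module.Basis (Σ i, Fin (s i)) R V}

theorem map (hf : IsJordanBasis f μ b) (φ : V ≃ₗ[R] W) :
    IsJordanBasis (φ.conj f) μ (b.map φ) := by
  intro i k
  simp only [Module.Basis.map_apply, LinearEquiv.conj_apply_apply, LinearEquiv.symm_apply_apply,
    hf i k, map_add, map_smul, apply_dite φ, map_zero]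

theorem exists_comp (hf : IsJordanBasis f μ b) {g : κ → ι} (hg : g.Injective)
    (hrange : ∀ i, 0 < s i → i ∈ Set.range g) :
    ∃ b' : Module.Basis (Σ j, Fin (s (g j))) R V, IsJordanBasis f (μ ∘ g) b' := by
  have hbij : (Sigma.map g fun _ => id :
      (Σ j, Fin (s (g j))) → Σ i, Fin (s i)).Bijective := by
    refine ⟨hg.sigma_map fun _ => Function.injective_id, ?_⟩
    rintro ⟨i, k⟩
    obtain ⟨j, rfl⟩ := hrange i k.pos
    exact ⟨⟨j, k⟩, rfl⟩
  refine ⟨b.reindex (Equiv.ofBijective _ hbij).symm, fun j k => ?_⟩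
  simp only [Module.Basis.reindex_apply]
  exact hf (g j) k

theorem directSum {M : ι → Type*} [∀ i, AddCommGroup (M i)] [∀ i, Module R (M i)]
    {g : ∀ i, Module.End R (M i)} {c : ∀ i, Module.Basis (Fin (s i)) R (M i)}
    (hc : ∀ i, IsJordanChain (g i) (μ i) (c i)) :
    IsJordanBasis (V := DirectSum ι M) (DirectSum.lmap g) μ (DFinsupp.basis c) := by
  classical
  have hbasis (i : ι) (k : Fin (s i)) :
      (DFinsupp.basis c : Module.Basis _ R (DirectSum ι M)) ⟨i, k⟩ =
        DirectSum.lof R ι M i (c i k) := by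
    apply (DFinsupp.basis c).repr.injective
    rw [Module.Basis.repr_self]
    change Finsupp.single (⟨i, k⟩ : Σ i, Fin (s i)) (1 : R) = sigmaFinsuppEquivDFinsupp.symm
      (DFinsupp.mapRange (fun i => (c i).repr) (fun _ => map_zero _) (DFinsupp.single i (c i k)))
    rw [Equiv.eq_symm_apply, sigmaFinsuppEquivDFinsupp_single, DFinsupp.mapRange_single,
      Module.Basis.repr_self]
  intro i k
  simp only [hbasis, DirectSum.lmap_lof, hc i k, map_add, map_smul,
    apply_dite (DirectSum.lof R ι M i), map_zero]

end IsJordanBasis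

theorem exists_chain_basis_quotient_X_sub_C_pow {R : Type*} [CommRing R] [Nontrivial R] (μ : R)
    (e : ℕ) :
    ∃ c : Module.Basis (Fin e) R (R[X] ⧸ Submodule.span R[X] {(X - C μ) ^ e}),
      IsJordanChain (Algebra.lsmul R R _ (X : R[X])) μ c := by
  set Q := R[X] ⧸ Submodule.span R[X] {(X - C μ) ^ e}
  let v (k : ℕ) : Q := Submodule.Quotient.mk ((X - C μ) ^ k)
  have hv {k : ℕ} (hk : e ≤ k) : v k = 0 :=
    (Submodule.Quotient.mk_eq_zero _).2 (Ideal.mem_span_singleton.2 (pow_dvd_pow _ hk))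
  have hX (k : ℕ) : (X : R[X]) • v k = μ • v k + v (k + 1) := by
    have h : (X : R[X]) • (X - C μ) ^ k = μ • (X - C μ) ^ k + (X - C μ) ^ (k + 1) := by
      rw [smul_eq_C_mul, smul_eq_mul]
      ring
    exact congrArg (Submodule.mkQ _) h
  have hspan : ⊤ ≤ Submodule.span R (Set.range fun k : Fin e => v k) := by
    rintro x -
    obtain ⟨p, rfl⟩ := Submodule.Quotient.mk_surjective _ x
    rw [← sum_taylor_eq p μ, Polynomial.sum_def, ← Submodule.mkQ_apply, map_sum]
    refine Submodule.sum_mem _ fun k _ => ?_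
    rw [← smul_eq_C_mul, Submodule.mkQ_apply, Submodule.Quotient.mk_smul]
    refine Submodule.smul_mem _ _ ?_
    by_cases hk : k < e
    · exact Submodule.subset_span ⟨⟨k, hk⟩, rfl⟩
    · exact (congrArg (· ∈ _) (hv (not_lt.1 hk))).mpr (Submodule.zero_mem _)
  have hfinrank : Module.finrank R Q = e := by
    have h := (AdjoinRoot.powerBasis' ((monic_X_sub_C μ).pow e)).finrank
    rwa [AdjoinRoot.powerBasis'_dim, (monic_X_sub_C μ).natDegree_pow, natDegree_X_sub_C,
      mul_one] at h
  refine ⟨basisOfTopLeSpanOfCardEqFinrank _ hspan (by rw [hfinrank, Fintype.card_fin]),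
    fun k => ?_⟩
  simp only [coe_basisOfTopLeSpanOfCardEqFinrank, Algebra.lsmul_coe, hX]
  congr 1
  split_ifs with h
  · rfl
  · exact hv (not_lt.1 h)

variable {K V : Type*} [Field K] [IsAlgClosed K] [AddCommGroup V] [Module K V]

theorem exists_chain_basis_quotient_irreducible_pow {p : K[X]} (hp : Irreducible p) (e : ℕ) :
    ∃ (μ : K) (c : Module.Basis (Fin e) K (K[X] ⧸ Submodule.span K[X] {p ^ e})),
      IsJordanChain (Algebra.lsmul K K _ (X : K[X])) μ c := by
  obtain ⟨μ, hμ⟩ := IsAlgClosed.exists_root p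
    (by rw [IsAlgClosed.degree_eq_one_of_irreducible K hp]; exact one_ne_zero)
  have hassoc : Associated p (X - C μ) :=
    ((irreducible_X_sub_C μ).associated_of_dvd hp (dvd_iff_isRoot.2 hμ)).symm
  refine ⟨μ, ?_⟩
  rw [show Submodule.span K[X] {p ^ e} = Submodule.span K[X] {(X - C μ) ^ e} from
    Ideal.span_singleton_eq_span_singleton.2 hassoc.pow_pow]
  exact exists_chain_basis_quotient_X_sub_C_pow μ e

theorem exists_isJordanBasis [FiniteDimensional K V] (f : Module.End K V) :
    ∃ (n : ℕ) (s : Fin n → ℕ) (μ : Fin n → K) (b : Module.Basis (Σ i, Fin (s i)) K V),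
      (∀ i, 0 < s i) ∧ IsJordanBasis f μ b := by
  classical
  obtain ⟨ι, _, p, hp, e, ⟨Φ⟩⟩ := Module.equiv_directSum_of_isTorsion
    (Module.AEval.isTorsion_of_finiteDimensional K V f)
  choose μ c hc using fun i => exists_chain_basis_quotient_irreducible_pow (hp i) (e i)
  let Ψ := (Module.AEval'.of f).trans (Φ.restrictScalars K)
  let g (i : ι) := Algebra.lsmul K K (K[X] ⧸ Submodule.span K[X] {p i ^ e i}) (X : K[X])
  have hΨ : Ψ.symm.conj (DirectSum.lmap g) = f := by
    have hlmap (y) : DirectSum.lmap g y = (X : K[X]) • y := DFinsupp.ext fun i => rfl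
    refine LinearMap.ext fun v => (Ψ.symm_apply_eq).2 ?_
    rw [hlmap, LinearEquiv.symm_symm]
    change (X : K[X]) • Φ (Module.AEval'.of f v) = Φ (Module.AEval'.of f (f v))
    rw [← Module.AEval'.X_smul_of, map_smul]
  have hb := (IsJordanBasis.directSum (g := g) hc).map Ψ.symm
  rw [hΨ] at hb
  obtain ⟨n, ⟨enum⟩⟩ := Finite.exists_equiv_fin {i // 0 < e i}
  obtain ⟨b, hb⟩ := hb.exists_comp (g := fun j => (enum.symm j : ι))
    (Subtype.val_injective.comp enum.symm.injective) fun i hi => ⟨enum ⟨i, hi⟩, by simp⟩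
  exact ⟨n, _, _, b, fun j => (enum.symm j).2, hb⟩

end JordanBasisExistence

section JordanForm

/-- `J` is a Jordan form of the endomorphism `f`, that is, `f` has a Jordan basis whose chains have
the eigenvalues and lengths of the blocks of `J`. For matrices this agrees with `IsJordanForm`,
see `isJordanForm_iff`. -/
def HasJordanForm {V : Type*} [AddCommGroup V] [Module ℂ V] (f : Module.End ℂ V)
    (J : JordanBlocks) : Prop :=
  ∃ b : Module.Basis (Σ i, Fin (J.size i)) ℂ V, IsJordanBasis f J.eigenvalue b

variable {V : Type*} [AddCommGroup V] [Module ℂ V]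

theorem exists_hasJordanForm [FiniteDimensional ℂ V] (f : Module.End ℂ V) :
    ∃ J : JordanBlocks, HasJordanForm f J := by
  obtain ⟨n, s, μ, b, hs, hb⟩ := exists_isJordanBasis f
  exact ⟨⟨n, μ, s, hs⟩, b, hb⟩

theorem sum_jordanBlock_smul {m : ℕ} (μ : ℂ) (v : Fin m → V) (k : Fin m) :
    ∑ l, jordanBlock μ m l k • v l =
      μ • v k + if h : (k : ℕ) + 1 < m then v ⟨k + 1, h⟩ else 0 := by
  have hsplit (l : Fin m) : jordanBlock μ m l k • v l =
      (if l = k then μ • v l else 0) + if (l : ℕ) = k + 1 then v l else 0 := by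
    rw [jordanBlock, Matrix.of_apply]
    split_ifs <;> simp_all
  simp only [hsplit, Finset.sum_add_distrib, Finset.sum_ite_eq', Finset.mem_univ, if_true]
  congr 1
  split_ifs with h
  · simpa [Fin.ext_iff] using
      Finset.sum_ite_eq' Finset.univ (⟨k + 1, h⟩ : Fin m) v
  · exact Finset.sum_eq_zero fun l _ => if_neg (by omega)

theorem sum_toMatrix_smul (J : JordanBlocks) (v : (Σ i, Fin (J.size i)) → V) (i : Fin J.numBlocks)
    (k : Fin (J.size i)) :
    ∑ a, J.toMatrix a ⟨i, k⟩ • v a =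
      ∑ l, jordanBlock (J.eigenvalue i) (J.size i) l k • v ⟨i, l⟩ := by
  rw [Fintype.sum_sigma, Finset.sum_eq_single i]
  · simp only [JordanBlocks.toMatrix, Matrix.blockDiagonal'_apply_eq]
  · intro j _ hj
    refine Finset.sum_eq_zero fun l _ => ?_
    rw [JordanBlocks.toMatrix, Matrix.blockDiagonal'_apply_ne _ _ _ hj, zero_smul]
  · simp

theorem isJordanBasis_iff_toMatrix_eq {f : Module.End ℂ V} {J : JordanBlocks}
    {b : Module.Basis (Σ i, Fin (J.size i)) ℂ V} :
    IsJordanBasis f J.eigenvalue b ↔ LinearMap.toMatrix b b f = J.toMatrix := by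
  have hbasis : IsJordanBasis (Matrix.toLin b b J.toMatrix) J.eigenvalue b := fun i k => by
    rw [Matrix.toLin_self, sum_toMatrix_smul,
      sum_jordanBlock_smul (J.eigenvalue i) fun l => b ⟨i, l⟩]
  constructor
  · intro hb
    rw [show f = Matrix.toLin b b J.toMatrix from
      b.ext fun ⟨i, k⟩ => (hb i k).trans (hbasis i k).symm, LinearMap.toMatrix_toLin]
  · intro hf
    rwa [← hf, Matrix.toLin_toMatrix] at hbasis

section ChangeOfBasis

variable {R M m n : Type*} [CommRing R] [AddCommGroup M] [Module R M] [Fintype m] [DecidableEq m]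
  [Fintype n] [DecidableEq n]

theorem exists_basis_toMatrix_eq (a : Module.Basis n R M) (P : GL n R) :
    ∃ b : Module.Basis n R M, a.toMatrix b = P := by
  refine ⟨a.map (Matrix.toLinearEquiv a P ((Matrix.isUnit_iff_isUnit_det _).1 P.isUnit)), ?_⟩
  ext i j
  simp [Module.Basis.toMatrix_apply, Matrix.toLin_self, Finsupp.single_apply]

theorem toMatrix_reindex (b : Module.Basis n R M) (e : n ≃ m) (f : Module.End R M) :
    LinearMap.toMatrix (b.reindex e) (b.reindex e) f =
      (LinearMap.toMatrix b b f).submatrix e.symm e.symm := by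
  ext i j
  simp [LinearMap.toMatrix_apply]

end ChangeOfBasis

theorem isJordanForm_iff {d : ℕ} {T : Matrix (Fin d) (Fin d) ℂ} {J : JordanBlocks} :
    IsJordanForm T J ↔ HasJordanForm (Matrix.toEuclideanCLM (𝕜 := ℂ) T).toLinearMap J := by
  let a := PiLp.basisFun 2 ℂ (Fin d)
  set f : Module.End ℂ (EuclideanSpace ℂ (Fin d)) := (Matrix.toEuclideanCLM (𝕜 := ℂ) T).toLinearMap
  have hf : LinearMap.toMatrix a a f = T := by
    rw [show f = Matrix.toLin a a T by
      simp only [f, a, Matrix.coe_toEuclideanCLM_eq_toEuclideanLin, Matrix.toLpLin_eq_toLin],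
      LinearMap.toMatrix_toLin]
  constructor
  · rintro ⟨e, P, hP⟩
    obtain ⟨b, hb⟩ := exists_basis_toMatrix_eq a P
    have hb' : b.toMatrix a = (P⁻¹ : GL (Fin d) ℂ) :=
      left_inv_eq_right_inv (hb ▸ b.toMatrix_mul_toMatrix_flip a) P.mul_inv
    have hfb : LinearMap.toMatrix b b f = J.toMatrix.submatrix e e := by
      rw [← basis_toMatrix_mul_linearMap_toMatrix_mul_basis_toMatrix b a b a, hf, hb, hb', hP]
      simp only [Matrix.mul_assoc, Units.inv_mul, Units.inv_mul_cancel_left, Matrix.mul_one]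
    refine ⟨b.reindex e, isJordanBasis_iff_toMatrix_eq.2 ?_⟩
    rw [toMatrix_reindex, hfb, Matrix.submatrix_submatrix, e.self_comp_symm, Matrix.submatrix_id_id]
  · rintro ⟨b, hb⟩
    let e := a.indexEquiv b
    let c := b.reindex e.symm
    refine ⟨e, ⟨a.toMatrix c, c.toMatrix a, a.toMatrix_mul_toMatrix_flip c,
      c.toMatrix_mul_toMatrix_flip a⟩, ?_⟩
    have hfc : LinearMap.toMatrix c c f = J.toMatrix.submatrix e e := by
      rw [toMatrix_reindex, isJordanBasis_iff_toMatrix_eq.1 hb, Equiv.symm_symm]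
    rw [← hfc, ← hf]
    exact (basis_toMatrix_mul_linearMap_toMatrix_mul_basis_toMatrix a c a c f).symm

end JordanForm

section Growth

/-- The sequence `n ^ p * r ^ n`, which measures the growth of the powers of a Jordan block of size
`p + 1` whose eigenvalue has modulus `r`. -/
noncomputable def growth (r : ℝ) (p n : ℕ) : ℝ :=
  n ^ p * r ^ n

theorem growth_isLittleO_growth {r : ℝ} {q p : ℕ} (h : q < p) :
    growth r q =o[atTop] growth r p :=
  ((isLittleO_pow_pow_atTop_of_lt h).comp_tendsto tendsto_natCast_atTop_atTop).mul_isBigO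
    (isBigO_refl _ _)

theorem growth_isLittleO_growth_of_lt {ρ r : ℝ} (hρ : 0 ≤ ρ) (h : ρ < r) (q p : ℕ) :
    growth ρ q =o[atTop] growth r p := by
  refine (isLittleO_pow_const_mul_const_pow_const_pow_of_norm_lt q
    ((Real.norm_of_nonneg hρ).trans_lt h)).trans_isBigO (.of_bound 1 ?_)
  filter_upwards [eventually_ge_atTop 1] with n hn
  have hn' : (1 : ℝ) ≤ n ^ p := one_le_pow₀ (Nat.one_le_cast.2 hn)
  rw [one_mul, growth, norm_mul, Real.norm_of_nonneg (zero_le_one.trans hn')]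
  exact le_mul_of_one_le_left (norm_nonneg _) hn'

variable {𝕜 : Type*} [RCLike 𝕜]

theorem jordanPowCoeff_isTheta (μ : 𝕜) (q : ℕ) :
    jordanPowCoeff μ q =Θ[atTop] growth ‖μ‖ q := by
  have hchoose : (fun n : ℕ => (n.choose q : 𝕜)) =Θ[atTop] fun n : ℕ => (n : ℝ) ^ q :=
    (IsTheta.of_norm_eventuallyEq (.of_forall fun n => by simp)).trans (isTheta_choose q)
  have hpow : (fun n => μ ^ (n - q)) =Θ[atTop] fun n => ‖μ‖ ^ n := by
    rcases eq_or_ne μ 0 with rfl | hμ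
    · refine IsTheta.of_norm_eventuallyEq ?_
      filter_upwards [eventually_gt_atTop q] with n hn
      simp [zero_pow (Nat.sub_pos_of_lt hn).ne', zero_pow (Nat.zero_lt_of_lt hn).ne']
    · have hμ' : ‖μ‖ ^ q ≠ 0 := pow_ne_zero _ (norm_ne_zero_iff.2 hμ)
      refine IsTheta.trans (g := fun n => (‖μ‖ ^ q)⁻¹ * ‖μ‖ ^ n) ?_
        (isTheta_rfl.const_mul_left (inv_ne_zero hμ'))
      refine IsTheta.of_norm_eventuallyEq ?_
      filter_upwards [eventually_ge_atTop q] with n hn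
      rw [norm_pow, pow_sub₀ _ (norm_ne_zero_iff.2 hμ) hn, mul_comm]
  exact hchoose.mul hpow

theorem jordanPowCoeff_isLittleO {μ : 𝕜} {r : ℝ} (hμ : ‖μ‖ ≤ r) {q p : ℕ}
    (h : ‖μ‖ = r → q < p) : jordanPowCoeff μ q =o[atTop] growth r p := by
  refine (jordanPowCoeff_isTheta μ q).isBigO.trans_isLittleO ?_
  rcases hμ.lt_or_eq with hlt | rfl
  · exact growth_isLittleO_growth_of_lt (norm_nonneg μ) hlt q p
  · exact growth_isLittleO_growth (h rfl)

namespace IsJordanBasis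

variable {V ι : Type*} [AddCommGroup V] [Module 𝕜 V] {s : ι → ℕ} {f : Module.End 𝕜 V} {μ : ι → 𝕜}
  {b : Module.Basis (Σ i, Fin (s i)) 𝕜 V} {i : ι} {x : V} {k l q : ℕ}

theorem coord_pow_isLittleO (hf : IsJordanBasis f μ b) {r : ℝ} (hμ : ‖μ i‖ ≤ r)
    (hx : ∀ m < l, coord b i m x = 0) (h : ‖μ i‖ = r → k < q + l) :
    (fun n => coord b i k ((f ^ n) x)) =o[atTop] growth r q := by
  rcases lt_or_ge k (s i) with hk | hk
  · simp only [hf.coord_pow hk]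
    refine IsLittleO.fun_sum fun am ham => ?_
    rw [mem_antidiagonal] at ham
    rcases lt_or_ge am.2 l with hm | hm
    · simp [hx _ hm]
    · have ha : ‖μ i‖ = r → am.1 < q := fun hr => by have := h hr; omega
      simpa only [mul_comm] using
        (jordanPowCoeff_isLittleO (μ := μ i) hμ ha).const_mul_left (coord b i am.2 x)
  · simp [coord_of_le hk]

theorem coord_pow_sub_isLittleO (hf : IsJordanBasis f μ b) (hk : q + l < s i)
    (hx : ∀ m < l, coord b i m x = 0) :
    (fun n => coord b i (q + l) ((f ^ n) x) - jordanPowCoeff (μ i) q n * coord b i l x)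
      =o[atTop] growth ‖μ i‖ q := by
  have hql : (q, l) ∈ antidiagonal (q + l) := mem_antidiagonal.2 rfl
  simp only [hf.coord_pow hk, ← Finset.sum_erase_eq_sub hql]
  refine IsLittleO.fun_sum fun am ham => ?_
  obtain ⟨hne, ham⟩ := Finset.mem_erase.1 ham
  rw [mem_antidiagonal] at ham
  rcases lt_or_ge am.2 l with hm | hm
  · simp [hx _ hm]
  · have ha : am.1 < q := by
      by_contra! ha
      exact hne (Prod.ext (by omega) (by omega))
    simpa only [mul_comm] using
      (jordanPowCoeff_isLittleO (μ := μ i) le_rfl fun _ => ha).const_mul_left (coord b i am.2 x)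

theorem coord_pow_isBigO (hf : IsJordanBasis f μ b) (hk : q + l < s i)
    (hx : ∀ m < l, coord b i m x = 0) :
    (fun n => coord b i (q + l) ((f ^ n) x)) =O[atTop] growth ‖μ i‖ q := by
  have hlead := (jordanPowCoeff_isTheta (μ i) q).isBigO.const_mul_left (coord b i l x)
  simpa [mul_comm] using (hf.coord_pow_sub_isLittleO hk hx).isBigO.add hlead

theorem coord_pow_isTheta (hf : IsJordanBasis f μ b) (hk : q + l < s i)
    (hx : ∀ m < l, coord b i m x = 0) (hxl : coord b i l x ≠ 0) :
    (fun n => coord b i (q + l) ((f ^ n) x)) =Θ[atTop] growth ‖μ i‖ q := by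
  have hlead : (fun n => jordanPowCoeff (μ i) q n * coord b i l x) =Θ[atTop] growth ‖μ i‖ q := by
    simpa only [mul_comm] using (jordanPowCoeff_isTheta (μ i) q).const_mul_left hxl
  have hequiv : (fun n => coord b i (q + l) ((f ^ n) x)) ~[atTop]
      fun n => jordanPowCoeff (μ i) q n * coord b i l x :=
    (hf.coord_pow_sub_isLittleO hk hx).trans_isTheta hlead.symm
  exact hequiv.isTheta.trans hlead

end IsJordanBasis

end Growth

section LinearIndependentPair

variable {𝕜 E F : Type*} [NontriviallyNormedField 𝕜] [NormedAddCommGroup E] [NormedSpace 𝕜 E]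
  [NormedAddCommGroup F] [NormedSpace 𝕜 F]

theorem dense_ne_zero [PreconnectedSpace E] {q : E → 𝕜} (hq : ∀ x, AnalyticAt 𝕜 q x) {x₀ : E}
    (hx₀ : q x₀ ≠ 0) : Dense {x | q x ≠ 0} := by
  refine interior_eq_empty_iff_dense_compl.1 (Set.eq_empty_of_forall_notMem fun x hx => hx₀ ?_)
  have hzero : q =ᶠ[𝓝 x] 0 := mem_interior_iff_mem_nhds.1 hx
  exact congrFun (AnalyticOnNhd.eq_of_eventuallyEq (fun z _ => hq z)
    (fun _ _ => analyticAt_const) hzero) x₀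

theorem isOpen_linearIndependent_pair [CompleteSpace 𝕜] (A B : E →L[𝕜] F) :
    IsOpen {x | LinearIndependent 𝕜 ![A x, B x]} :=
  isOpen_setOfPred_linearIndependent.preimage (f := fun x => ![A x, B x]) (by fun_prop)

variable [SeparatingDual 𝕜 F]

theorem linearIndependent_pair_iff_exists_dual {u v : F} :
    LinearIndependent 𝕜 ![u, v] ↔ ∃ f g : F →L[𝕜] 𝕜, f u * g v - g u * f v ≠ 0 := by
  constructor
  · intro h
    have hu : u ≠ 0 := h.ne_zero 0
    obtain ⟨f, hf⟩ := SeparatingDual.exists_ne_zero (R := 𝕜) hu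
    obtain ⟨g, hg⟩ := SeparatingDual.exists_separating_of_ne (R := 𝕜)
      ((LinearIndependent.pair_iff' hu).1 h (f v / f u))
    refine ⟨f, g, fun h0 => hg ?_⟩
    rw [map_smul, smul_eq_mul, div_mul_eq_mul_div, div_eq_iff hf]
    linear_combination -h0
  · rintro ⟨f, g, hfg⟩
    refine LinearIndependent.pair_iff.2 fun s t hst => ?_
    have hf : s * f u + t * f v = 0 := by simpa using congrArg f hst
    have hg : s * g u + t * g v = 0 := by simpa using congrArg g hst
    constructor
    · exact (mul_eq_zero.1 (by linear_combination g v * hf - f v * hg)).resolve_right hfg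
    · exact (mul_eq_zero.1 (by linear_combination f u * hg - g u * hf)).resolve_right hfg

theorem dense_linearIndependent_pair [PreconnectedSpace E] {A B : E →L[𝕜] F} {x₀ : E}
    (hx₀ : LinearIndependent 𝕜 ![A x₀, B x₀]) :
    Dense {x | LinearIndependent 𝕜 ![A x, B x]} := by
  obtain ⟨f, g, hfg⟩ := linearIndependent_pair_iff_exists_dual.1 hx₀
  have hq : ∀ x, AnalyticAt 𝕜 (fun x => f (A x) * g (B x) - g (A x) * f (B x)) x := fun x =>
    (((f ∘L A).analyticAt x).mul ((g ∘L B).analyticAt x)).sub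
      (((g ∘L A).analyticAt x).mul ((f ∘L B).analyticAt x))
  exact (dense_ne_zero hq hfg).mono fun x hx =>
    linearIndependent_pair_iff_exists_dual.2 ⟨f, g, hx⟩

end LinearIndependentPair

theorem exists_smul_eq_of_not_linearIndependent {K V W : Type*} [Field K] [AddCommGroup V]
    [Module K V] [AddCommGroup W] [Module K W] {A B : V →ₗ[K] W}
    (h : ∀ x, ¬ LinearIndependent K ![A x, B x]) {x₀ y : V} (hA : A x₀ = 0) (hB : B x₀ ≠ 0)
    (hy : A y ≠ 0) : ∃ α β : K, A y = α • B x₀ ∧ B y = β • B x₀ := by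
  have hmul : ∀ z, A z = A y → ∃ γ : K, γ • A y = B z := fun z hz => by
    have hdep := h z
    rw [hz, LinearIndependent.pair_iff' hy] at hdep
    simpa only [not_forall, not_not] using hdep
  obtain ⟨γ, hγ⟩ := hmul y rfl
  obtain ⟨δ, hδ⟩ := hmul (y + x₀) (by rw [map_add, hA, add_zero])
  have hdiff : (δ - γ) • A y = B x₀ := by rw [sub_smul, hγ, hδ, map_add, add_sub_cancel_left]
  have hne : δ - γ ≠ 0 := fun h0 => hB (by rw [← hdiff, h0, zero_smul])
  have hAy : A y = (δ - γ)⁻¹ • B x₀ := by rw [← hdiff, inv_smul_smul₀ hne]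
  exact ⟨_, γ * (δ - γ)⁻¹, hAy, by rw [← hγ, hAy, smul_smul]⟩

section OrbitReflexivity

variable {X : Type*} [NormedAddCommGroup X] [NormedSpace ℂ X] {T S : X →L[ℂ] X}

theorem mem_sotClosure_of_tendsto {c : ℕ → ℂ} {n : ℕ → ℕ}
    (h : ∀ x, Tendsto (fun k => c k • (T ^ n k) x) atTop (𝓝 (S x))) : S ∈ sotClosure (orb T) := by
  change ContinuousLinearMap.toPointwiseConvergenceCLM ℂ (RingHom.id ℂ) X X S ∈ closure
    (ContinuousLinearMap.toPointwiseConvergenceCLM ℂ (RingHom.id ℂ) X X '' orb T)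
  refine mem_closure_of_tendsto (b := atTop)
    (f := fun k => ContinuousLinearMap.toPointwiseConvergenceCLM ℂ (RingHom.id ℂ) X X
      (c k • T ^ n k)) ?_ (.of_forall fun k => Set.mem_image_of_mem _ ⟨c k, n k, rfl⟩)
  rw [PointwiseConvergenceCLM.tendsto_iff_forall_tendsto]
  exact h

theorem orb_subset_sotClosure_orb : orb T ⊆ sotClosure (orb T) :=
  fun _ hS => subset_closure
    (s := ContinuousLinearMap.toPointwiseConvergenceCLM ℂ (RingHom.id ℂ) X X '' orb T)
    (Set.mem_image_of_mem _ hS)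

theorem sotClosure_orb_subset_orbRef : sotClosure (orb T) ⊆ orbRef T := by
  intro S hS x
  refine map_mem_closure (f := fun A : X →Lₚₜ[ℂ] X => A x)
    (ContinuousEvalConst.continuous_eval_const x) hS ?_
  rintro _ ⟨_, ⟨c, n, rfl⟩, rfl⟩
  exact ⟨c, n, rfl⟩

theorem apply_comm_of_mem_sotClosure_orb (hS : S ∈ sotClosure (orb T)) (x : X) :
    S (T x) = T (S x) := by
  have hclosed : IsClosed {A : X →Lₚₜ[ℂ] X | A (T x) = T (A x)} :=
    isClosed_eq (ContinuousEvalConst.continuous_eval_const (T x))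
      (T.continuous.comp (ContinuousEvalConst.continuous_eval_const x))
  refine (closure_minimal ?_ hclosed) hS
  rintro _ ⟨_, ⟨c, n, rfl⟩, rfl⟩
  change c • (T ^ n) (T x) = T (c • (T ^ n) x)
  rw [map_smul, ← mul_apply_eq_comp, ← mul_apply_eq_comp, pow_mul_comm']

theorem smul_mem_closure_orbAt (a : ℂ) {x y : X} (hy : y ∈ closure (orbAt T x)) :
    a • y ∈ closure (orbAt T x) := by
  refine map_mem_closure (continuous_const_smul a) hy ?_
  rintro _ ⟨c, n, rfl⟩
  exact ⟨a * c, n, smul_smul a c _⟩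

theorem apply_mem_of_mem_orbRef (hS : S ∈ orbRef T) {x : X} {C : Set X} (hC : IsClosed C)
    (h : ∀ (c : ℂ) (n : ℕ), c • (T ^ n) x ∈ C) : S x ∈ C := by
  refine closure_minimal ?_ hC (hS x)
  rintro _ ⟨c, n, rfl⟩
  exact h c n

theorem pow_apply_eq_zero_of_mem_orbRef (hS : S ∈ orbRef T) {n : ℕ} {x : X}
    (hx : (T ^ n) x = 0) : (T ^ n) (S x) = 0 := by
  refine apply_mem_of_mem_orbRef hS
    (isClosed_eq (T ^ n).continuous (continuous_const (y := 0))) fun c m => ?_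
  rw [Set.mem_ofPred_eq, map_smul, ← mul_apply_eq_comp, (Commute.refl T).pow_pow n m,
    mul_apply_eq_comp, hx, map_zero, smul_zero]

theorem mem_orb_of_not_linearIndependent (hT : ¬ IsNilpotent T) (hS : S ∈ orbRef T) {n : ℕ}
    (h : ∀ x, ¬ LinearIndependent ℂ ![S x, (T ^ n) x]) : S ∈ orb T := by
  obtain ⟨x₀, hx₀⟩ : ∃ x₀, (T ^ n) ((T ^ n) x₀) ≠ 0 := by
    by_contra! h0
    exact hT ⟨n + n, by ext x; simpa [pow_add] using h0 x⟩
  have hw : (T ^ n) x₀ ≠ 0 := fun h0 => hx₀ (by rw [h0, map_zero])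
  obtain ⟨α, hα⟩ : ∃ α : ℂ, α • (T ^ n) x₀ = S x₀ := by
    have := h x₀
    rw [LinearIndependent.pair_symm_iff, LinearIndependent.pair_iff' hw] at this
    simpa using this
  suffices hR : S - α • T ^ n = 0 from ⟨α, n, sub_eq_zero.1 hR⟩
  by_contra! hR
  obtain ⟨y, hy⟩ : ∃ y, (S - α • T ^ n) y ≠ 0 := DFunLike.ne_iff.1 hR
  have hdep : ∀ x, ¬ LinearIndependent ℂ ![(S - α • T ^ n) x, (T ^ n) x] := fun x hx => h x <| by
    simpa using (LinearIndependent.pair_add_smul_left_iff α).2 hx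
  obtain ⟨β, δ, hβ, hδ⟩ : ∃ β δ : ℂ,
      (S - α • T ^ n) y = β • (T ^ n) x₀ ∧ (T ^ n) y = δ • (T ^ n) x₀ :=
    exists_smul_eq_of_not_linearIndependent (A := (S - α • T ^ n).toLinearMap)
      (B := (T ^ n).toLinearMap) hdep (sub_eq_zero.2 hα.symm) hw hy
  have hker : (T ^ n) (y - δ • x₀) = 0 := by rw [map_sub, map_smul, hδ, sub_self]
  have hSy : S (y - δ • x₀) = β • (T ^ n) x₀ := by
    rw [map_sub, map_smul, ← hα, smul_comm, ← hδ]
    exact hβ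
  have hβ0 : β • (T ^ n) ((T ^ n) x₀) = 0 := by
    rw [← map_smul, ← hSy, pow_apply_eq_zero_of_mem_orbRef hS hker]
  rw [(smul_eq_zero.1 hβ0).resolve_right hx₀, zero_smul] at hβ
  exact hy hβ

theorem exists_tendsto_of_mem_closure_orbAt {x y : X} (hy : y ∈ closure (orbAt T x))
    (h : ∀ n, y ∉ ℂ ∙ (T ^ n) x) : ∃ (c : ℕ → ℂ) (n : ℕ → ℕ), Tendsto n atTop atTop ∧
      Tendsto (fun k => c k • (T ^ n k) x) atTop (𝓝 y) := by
  obtain ⟨u, hu, hlim⟩ := mem_closure_iff_seq_limit.1 hy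
  choose c n hcn using hu
  obtain rfl : u = fun k => c k • (T ^ n k) x := funext hcn
  refine ⟨c, n, ?_, hlim⟩
  suffices Tendsto n atTop cofinite from Nat.cofinite_eq_atTop ▸ this
  refine le_cofinite_iff_eventually_ne.2 fun m => eventually_map.2 ?_
  filter_upwards [hlim.eventually
    ((ℂ ∙ (T ^ m) x).closed_of_finiteDimensional.isOpen_compl.mem_nhds (h m))] with k hk hkm
  exact hk (hkm ▸ Submodule.smul_mem _ _ (Submodule.mem_span_singleton_self _))

theorem dense_exists_tendsto [CompleteSpace X] (hT : ¬ IsNilpotent T) (hS : S ∈ orbRef T)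
    (hS' : S ∉ orb T) {κ : Type*} [Countable κ] {f : κ → X →L[ℂ] ℂ} (hf : ∀ i, f i ≠ 0) :
    Dense {x | (∀ i, f i x ≠ 0) ∧ ∃ (c : ℕ → ℂ) (n : ℕ → ℕ), Tendsto n atTop atTop ∧
      Tendsto (fun k => c k • (T ^ n k) x) atTop (𝓝 (S x))} := by
  have hli : ∀ n, Dense {x | LinearIndependent ℂ ![S x, (T ^ n) x]} := fun n => by
    obtain ⟨x₀, hx₀⟩ := not_forall_not.1 (mt (mem_orb_of_not_linearIndependent hT hS) hS')
    exact dense_linearIndependent_pair hx₀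
  have hne : ∀ i, Dense {x | f i x ≠ 0} := fun i => by
    obtain ⟨x₀, hx₀⟩ := DFunLike.ne_iff.1 (hf i)
    exact dense_ne_zero (f i).analyticAt hx₀
  have hdense := dense_iInter_of_isOpen
    (f := Sum.elim (fun i => {x | f i x ≠ 0})
      fun n => {x | LinearIndependent ℂ ![S x, (T ^ n) x]})
    (Sum.forall.2 ⟨fun i => isOpen_ne_fun (f i).continuous continuous_const,
      fun n => isOpen_linearIndependent_pair S (T ^ n)⟩)
    (Sum.forall.2 ⟨hne, hli⟩)
  refine hdense.mono fun x hx => ?_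
  obtain ⟨hfx, hSx⟩ := Sum.forall.1 (Set.mem_iInter.1 hx)
  refine ⟨hfx, exists_tendsto_of_mem_closure_orbAt (hS x) fun n hmem => ?_⟩
  obtain ⟨a, ha⟩ := Submodule.mem_span_singleton.1 hmem
  have hTx : (T ^ n) x ≠ 0 := (hSx n).ne_zero 1
  exact (LinearIndependent.pair_iff' hTx).1 (LinearIndependent.pair_symm_iff.1 (hSx n)) a ha

end OrbitReflexivity

section LeadingBlock

/-- `i` is a leading block: its eigenvalue `μ i` has the largest modulus, and its size `s i` is the
largest one among the blocks with eigenvalues of that modulus. The first vector of such a chain has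
the fastest growing orbit. -/
structure IsLeadingBlock {𝕜 ι : Type*} [Norm 𝕜] (μ : ι → 𝕜) (s : ι → ℕ) (i : ι) : Prop where
  norm_le : ∀ j, ‖μ j‖ ≤ ‖μ i‖
  size_le : ∀ j, ‖μ j‖ = ‖μ i‖ → s j ≤ s i

theorem IsLeadingBlock.of_eq {𝕜 ι : Type*} [Norm 𝕜] {μ : ι → 𝕜} {s : ι → ℕ} {i j : ι}
    (hi : IsLeadingBlock μ s i) (hμ : ‖μ j‖ = ‖μ i‖) (hs : s j = s i) : IsLeadingBlock μ s j :=
  ⟨fun m => hμ ▸ hi.norm_le m, fun m hm => hs ▸ hi.size_le m (hm.trans hμ)⟩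

theorem exists_isLeadingBlock {𝕜 ι : Type*} [Norm 𝕜] [Finite ι] [Nonempty ι] (μ : ι → 𝕜)
    (s : ι → ℕ) : ∃ i, IsLeadingBlock μ s i := by
  obtain ⟨i, hi⟩ := Finite.exists_max fun i => toLex (‖μ i‖, s i)
  simp only [Prod.Lex.toLex_le_toLex] at hi
  exact ⟨i, fun j => (hi j).elim le_of_lt fun h => h.1.le,
    fun j hj => (hi j).elim (fun h => absurd hj h.ne) And.right⟩

theorem IsJordanBasis.coord_pow_isLittleO_coord_pow {𝕜 V ι : Type*} [RCLike 𝕜] [AddCommGroup V]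
    [Module 𝕜 V] {s : ι → ℕ} {f : Module.End 𝕜 V} {μ : ι → 𝕜}
    {b : Module.Basis (Σ i, Fin (s i)) 𝕜 V} {i j : ι} {p k : ℕ} {x z : V}
    (hf : IsJordanBasis f μ b) (hi : IsLeadingBlock μ s i) (hp : s i = p + 1)
    (hx : coord b i 0 x ≠ 0) (hz : ‖μ j‖ = ‖μ i‖ → k = p → coord b j 0 z = 0) :
    (fun n => coord b j k ((f ^ n) z)) =o[atTop] fun n => coord b i p ((f ^ n) x) := by
  have hlead : (fun n => coord b i p ((f ^ n) x)) =Θ[atTop] growth ‖μ i‖ p :=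
    hf.coord_pow_isTheta (l := 0) (hp ▸ p.lt_succ_self) (by simp) hx
  refine IsLittleO.trans_isTheta ?_ hlead.symm
  rcases le_or_gt (s j) k with hk | hk
  · simp [coord_of_le hk]
  by_cases h : ‖μ j‖ = ‖μ i‖ ∧ k = p
  · exact hf.coord_pow_isLittleO (l := 1) (hi.norm_le j) (by simpa using hz h.1 h.2)
      fun _ => by omega
  · refine hf.coord_pow_isLittleO (l := 0) (hi.norm_le j) (by simp) fun hr => ?_
    have hkp : k ≠ p := fun hkp => h ⟨hr, hkp⟩
    have := hi.size_le j hr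
    omega

theorem tendsto_mul_comp_zero_of_isLittleO {𝕜 α β : Type*} [NormedField 𝕜] {l : Filter α}
    {l' : Filter β} {f g : β → 𝕜} {c : α → 𝕜} {n : α → β} {a : 𝕜} (hfg : f =o[l'] g)
    (hn : Tendsto n l l') (hg : Tendsto (fun m => c m * g (n m)) l (𝓝 a)) :
    Tendsto (fun m => c m * f (n m)) l (𝓝 0) :=
  (isLittleO_one_iff 𝕜).1 <| ((isBigO_refl c l).mul_isLittleO (hfg.comp_tendsto hn)).trans_isBigO
    (hg.isBigO_one 𝕜)

variable {V ι : Type*} [NormedAddCommGroup V] [NormedSpace ℂ V] [Finite ι] {s : ι → ℕ}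
  {b : Module.Basis (Σ i, Fin (s i)) ℂ V} {T S : V →L[ℂ] V} {μ : ι → ℂ} {i j : ι} {p k : ℕ}
  {c : ℕ → ℂ} {n : ℕ → ℕ} {x y z : V}

theorem continuous_coord (b : Module.Basis (Σ i, Fin (s i)) ℂ V) (i : ι) (k : ℕ) :
    Continuous (coord b i k) :=
  have := b.finiteDimensional_of_finite
  LinearMap.continuous_of_finiteDimensional _

theorem tendsto_of_tendsto_coord {α : Type*} {l : Filter α} {u : α → V} {v : V}
    (h : ∀ i, ∀ k < s i, Tendsto (fun a => coord b i k (u a)) l (𝓝 (coord b i k v))) :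
    Tendsto u l (𝓝 v) := by
  have := Fintype.ofFinite ι
  refine b.equivFunL.toHomeomorph.isInducing.tendsto_nhds_iff.2 (tendsto_pi_nhds.2 ?_)
  rintro ⟨i, k⟩
  simpa [coord_fin] using h i k k.is_lt

theorem IsLeadingBlock.tendsto_coord_zero (hi : IsLeadingBlock μ s i) (hp : s i = p + 1)
    (hT : IsJordanBasis T.toLinearMap μ b) (hn : Tendsto n atTop atTop)
    (hlim : Tendsto (fun m => c m • (T ^ n m) x) atTop (𝓝 y)) (hx : coord b i 0 x ≠ 0)
    (hz : ‖μ j‖ = ‖μ i‖ → k = p → coord b j 0 z = 0) :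
    Tendsto (fun m => coord b j k (c m • (T ^ n m) z)) atTop (𝓝 0) := by
  have hpow : (fun n => coord b j k ((T ^ n) z)) =o[atTop] fun n => coord b i p ((T ^ n) x) := by
    simpa only [← ContinuousLinearMap.toLinearMap_pow, ContinuousLinearMap.coe_coe] using
      hT.coord_pow_isLittleO_coord_pow hi hp hx hz
  have hlead : Tendsto (fun m => coord b i p (c m • (T ^ n m) x)) atTop (𝓝 (coord b i p y)) :=
    ((continuous_coord b i p).tendsto y).comp hlim
  simp only [map_smul, smul_eq_mul] at hlead ⊢
  exact tendsto_mul_comp_zero_of_isLittleO (f := fun n => coord b j k ((T ^ n) z))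
    (g := fun n => coord b i p ((T ^ n) x)) hpow hn hlead

theorem IsLeadingBlock.tendsto_coord (hi : IsLeadingBlock μ s i) (hp : s i = p + 1)
    (hT : IsJordanBasis T.toLinearMap μ b) (hn : Tendsto n atTop atTop)
    (hlim : Tendsto (fun m => c m • (T ^ n m) x) atTop (𝓝 y)) (hx : coord b i 0 x ≠ 0)
    (hxj : coord b j 0 x ≠ 0) :
    Tendsto (fun m => coord b j p (c m • (T ^ n m) z)) atTop
      (𝓝 (coord b j 0 z / coord b j 0 x * coord b j p y)) := by
  set t := coord b j 0 z / coord b j 0 x with ht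
  have hzx : coord b j 0 (z - t • x) = 0 := by
    rw [map_sub, map_smul, smul_eq_mul, ht, div_mul_cancel₀ _ hxj, sub_self]
  have hdiff := hi.tendsto_coord_zero (k := p) hp hT hn hlim hx fun _ _ => hzx
  have hlead := (((continuous_coord b j p).tendsto y).comp hlim).const_mul t
  refine (zero_add (t * coord b j p y) ▸ hdiff.add hlead).congr fun m => ?_
  simp only [Function.comp_apply, map_sub, map_smul, smul_eq_mul]
  ring

theorem dense_coord_ne_zero_exists_tendsto (b : Module.Basis (Σ i, Fin (s i)) ℂ V)
    (hT : ¬ IsNilpotent T) (hS : S ∈ orbRef T) (hS' : S ∉ orb T) :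
    Dense {x | (∀ i, 0 < s i → coord b i 0 x ≠ 0) ∧ ∃ (c : ℕ → ℂ) (n : ℕ → ℕ),
      Tendsto n atTop atTop ∧ Tendsto (fun k => c k • (T ^ n k) x) atTop (𝓝 (S x))} := by
  have := b.finiteDimensional_of_finite
  have := FiniteDimensional.complete ℂ V
  refine (dense_exists_tendsto hT hS hS' (κ := {i // 0 < s i})
    (f := fun i => ⟨coord b i 0, continuous_coord b i 0⟩) fun i h0 => ?_).mono ?_
  · simpa [coord_basis_self i.1 ⟨0, i.2⟩] using DFunLike.congr_fun h0 (b ⟨i, ⟨0, i.2⟩⟩)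
  · exact fun x hx => ⟨fun i hi => hx.1 ⟨i, hi⟩, hx.2⟩

theorem IsLeadingBlock.coord_apply_eq_zero (hi : IsLeadingBlock μ s i) (hp : s i = p + 1)
    (hT : IsJordanBasis T.toLinearMap μ b) (hT' : ¬ IsNilpotent T) (hS : S ∈ orbRef T)
    (hS' : S ∉ orb T) (h : ‖μ j‖ = ‖μ i‖ → k ≠ p) (z : V) : coord b j k (S z) = 0 := by
  have hcont := continuous_coord b j k
  refine congrFun ((hcont.comp S.continuous).ext_on
    (dense_coord_ne_zero_exists_tendsto b hT' hS hS') continuous_zero ?_) z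
  rintro x ⟨hx, c, n, hn, hlim⟩
  exact tendsto_nhds_unique ((hcont.tendsto (S x)).comp hlim)
    (hi.tendsto_coord_zero hp hT hn hlim (hx i (by omega)) fun hr hk => (h hr hk).elim)

theorem IsJordanBasis.isNilpotent_of_toLinearMap (hT : IsJordanBasis T.toLinearMap μ b)
    (hμ : ∀ i, μ i = 0) : IsNilpotent T := by
  obtain ⟨n, hn⟩ := hT.isNilpotent hμ
  exact ⟨n, ContinuousLinearMap.coe_inj.1 (by simpa using hn)⟩

theorem IsLeadingBlock.eigenvalue_ne_zero (hi : IsLeadingBlock μ s i)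
    (hT : IsJordanBasis T.toLinearMap μ b) (hT' : ¬ IsNilpotent T) : μ i ≠ 0 := by
  intro hμi
  have hμ (j : ι) : μ j = 0 := norm_le_zero_iff.1 (by simpa [hμi] using hi.norm_le j)
  exact hT' (hT.isNilpotent_of_toLinearMap hμ)

theorem IsLeadingBlock.coord_apply_eq_zero_of_coord_zero_ne_zero (hi : IsLeadingBlock μ s i)
    (hp : s i = p + 2) (hT : IsJordanBasis T.toLinearMap μ b) (hT' : ¬ IsNilpotent T)
    (hS : S ∈ orbRef T) (hS' : S ∉ orb T) (hμ : ‖μ j‖ = ‖μ i‖) (hj : p < s j)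
    (hzi : coord b i 0 z = 0) (hzj : coord b j 0 z ≠ 0) : coord b i (p + 1) (S z) = 0 := by
  -- Along the orbit of `z` the coordinate `(i, p + 1)` grows no faster than `(j, p)`, which `S`
  -- annihilates; adding the nowhere vanishing coordinate `(j, 0)` makes the bound hold for all `n`.
  have hbigO : (fun n => coord b i (p + 1) ((T ^ n) z)) =O[atTop]
      fun n => (coord b j p ((T ^ n) z), coord b j 0 ((T ^ n) z)) := by
    have hi' := hT.coord_pow_isBigO (q := p) (l := 1) (i := i) (x := z) (by omega) (by simpa)
    have hj' := hT.coord_pow_isTheta (q := p) (l := 0) hj (by simp) hzj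
    have := hi'.trans (hμ ▸ hj'.symm.isBigO)
    simp only [← ContinuousLinearMap.toLinearMap_pow, ContinuousLinearMap.coe_coe] at this
    exact this.trans isBigO_fst_prod
  obtain ⟨C, -, hC⟩ := bound_of_isBigO_nat_atTop hbigO
  have hne (n : ℕ) : (coord b j p ((T ^ n) z), coord b j 0 ((T ^ n) z)) ≠ 0 := fun h0 => by
    have hμj : μ j ≠ 0 :=
      norm_ne_zero_iff.1 (hμ ▸ norm_ne_zero_iff.2 (hi.eigenvalue_ne_zero hT hT'))
    refine mul_ne_zero (pow_ne_zero n hμj) hzj ?_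
    rw [← hT.coord_zero_pow, ← ContinuousLinearMap.toLinearMap_pow]
    exact congrArg Prod.snd h0
  have hbound : ‖coord b i (p + 1) (S z)‖ ≤ C * ‖(coord b j p (S z), coord b j 0 (S z))‖ := by
    refine apply_mem_of_mem_orbRef hS
      (C := {w | ‖coord b i (p + 1) w‖ ≤ C * ‖(coord b j p w, coord b j 0 w)‖})
      (isClosed_le (continuous_coord b i _).norm (continuous_const.mul
        ((continuous_coord b j p).prodMk (continuous_coord b j 0)).norm)) fun c n => ?_
    simp only [Set.mem_ofPred_eq, map_smul, ← Prod.smul_mk, norm_smul]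
    rw [mul_left_comm]
    exact mul_le_mul_of_nonneg_left (hC (hne n)) (norm_nonneg c)
  have hp' (k : ℕ) (hk : k ≤ p) : coord b j k (S z) = 0 :=
    hi.coord_apply_eq_zero hp hT hT' hS hS' (fun _ => by omega) z
  simpa [hp' p le_rfl, hp' 0 p.zero_le] using hbound

theorem IsLeadingBlock.coord_apply_eq_zero_of_coord_zero_eq_zero (hi : IsLeadingBlock μ s i)
    (hp : s i = p + 1) (hT : IsJordanBasis T.toLinearMap μ b) (hT' : ¬ IsNilpotent T)
    (hS : S ∈ orbRef T) (hS' : S ∉ orb T)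
    (h : s i ≤ 1 ∨ ∃ j ≠ i, ‖μ j‖ = ‖μ i‖ ∧ s i ≤ s j + 1) (hz : coord b i 0 z = 0) :
    coord b i p (S z) = 0 := by
  rcases Nat.eq_zero_or_pos p with rfl | hp0
  · refine apply_mem_of_mem_orbRef hS
      (isClosed_eq (continuous_coord b i 0) (continuous_const (y := 0))) fun c n => ?_
    rw [Set.mem_ofPred_eq, map_smul, ← ContinuousLinearMap.coe_coe,
      ContinuousLinearMap.toLinearMap_pow, hT.coord_zero_pow, hz, mul_zero, smul_zero]
  obtain ⟨q, rfl⟩ := Nat.exists_eq_add_one.2 hp0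
  obtain ⟨j, hji, hμ, hsj⟩ := h.resolve_left (by omega)
  have hj : q < s j := by omega
  have hSw {w : V} (hwi : coord b i 0 w = 0) (hwj : coord b j 0 w ≠ 0) :
      coord b i (q + 1) (S w) = 0 :=
    hi.coord_apply_eq_zero_of_coord_zero_ne_zero hp hT hT' hS hS' hμ hj hwi hwj
  by_cases hzj : coord b j 0 z = 0
  · have hei : coord b i 0 (b ⟨j, ⟨0, by omega⟩⟩) = 0 := by
      classical simp [coord_basis, hji]
    have hej : coord b j 0 (b ⟨j, ⟨0, by omega⟩⟩) = 1 := coord_basis_self j ⟨0, by omega⟩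
    have hsum := hSw (w := z + b ⟨j, ⟨0, by omega⟩⟩) (by simp [hz, hei]) (by simp [hzj, hej])
    rwa [map_add, map_add, hSw hei (by simp [hej]), add_zero] at hsum
  · exact hSw hz hzj

theorem IsLeadingBlock.mem_sotClosure_orb (hi : IsLeadingBlock μ s i)
    (hp : s i = p + 1) (hT : IsJordanBasis T.toLinearMap μ b) (hT' : ¬ IsNilpotent T)
    (hS : S ∈ orbRef T) (hS' : S ∉ orb T)
    (h : ∀ j z, ‖μ j‖ = ‖μ i‖ → p < s j → coord b j 0 z = 0 → coord b j p (S z) = 0) :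
    S ∈ sotClosure (orb T) := by
  obtain ⟨x, hx, c, n, hn, hlim⟩ := (dense_coord_ne_zero_exists_tendsto b hT' hS hS').nonempty
  have hxi : coord b i 0 x ≠ 0 := hx i (by omega)
  refine mem_sotClosure_of_tendsto (c := c) (n := n) fun z =>
    tendsto_of_tendsto_coord (b := b) fun j k hk => ?_
  by_cases hjk : ‖μ j‖ = ‖μ i‖ ∧ k = p
  · obtain ⟨hr, rfl⟩ := hjk
    have hxj : coord b j 0 x ≠ 0 := hx j (by omega)
    have hSz : coord b j k (S z) = coord b j 0 z / coord b j 0 x * coord b j k (S x) := by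
      have hker := h j (z - (coord b j 0 z / coord b j 0 x) • x) hr hk
        (by rw [map_sub, map_smul, smul_eq_mul, div_mul_cancel₀ _ hxj, sub_self])
      rwa [map_sub, map_smul, map_sub, map_smul, smul_eq_mul, sub_eq_zero] at hker
    exact hSz ▸ hi.tendsto_coord hp hT hn hlim hxi hxj
  · rw [hi.coord_apply_eq_zero hp hT hT' hS hS' (fun hr hk => hjk ⟨hr, hk⟩)]
    exact hi.tendsto_coord_zero hp hT hn hlim hxi fun hr hk => (hjk ⟨hr, hk⟩).elim

theorem IsLeadingBlock.isOrbitReflexive (hi : IsLeadingBlock μ s i)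
    (hT : IsJordanBasis T.toLinearMap μ b) (hT' : ¬ IsNilpotent T) (hsi : 0 < s i)
    (h : s i ≤ 1 ∨ ∃ j ≠ i, ‖μ j‖ = ‖μ i‖ ∧ s i ≤ s j + 1) : IsOrbitReflexive T := by
  obtain ⟨p, hp⟩ := Nat.exists_eq_add_one.2 hsi
  refine (Set.Subset.antisymm sotClosure_orb_subset_orbRef fun S hS => ?_).symm
  by_cases hS' : S ∈ orb T
  · exact orb_subset_sotClosure_orb hS'
  refine hi.mem_sotClosure_orb hp hT hT' hS hS' fun j z hμ hj hz => ?_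
  have hsj : s j = s i := by
    have := hi.size_le j hμ
    omega
  refine (hi.of_eq hμ hsj).coord_apply_eq_zero_of_coord_zero_eq_zero (hsj.trans hp) hT hT' hS hS'
    ?_ hz
  rcases eq_or_ne j i with rfl | hji
  · exact h
  · exact .inr ⟨i, hji.symm, hμ.symm, by omega⟩

end LeadingBlock

section Characterization

variable {V ι : Type*} [NormedAddCommGroup V] [NormedSpace ℂ V] {s : ι → ℕ}
  {b : Module.Basis (Σ i, Fin (s i)) ℂ V} {T : V →L[ℂ] V} {μ : ι → ℂ} {i : ι} {q l : ℕ} {x : V}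

theorem IsJordanBasis.eventually_coord_pow_ne_zero (hT : IsJordanBasis T.toLinearMap μ b)
    (hμi : μ i ≠ 0) (hql : q + l < s i) (hx : ∀ m < l, coord b i m x = 0)
    (hxl : coord b i l x ≠ 0) : ∀ᶠ n in atTop, coord b i (q + l) ((T ^ n) x) ≠ 0 := by
  filter_upwards [(hT.coord_pow_isTheta hql hx hxl).eq_zero_iff, eventually_ge_atTop 1]
    with n hn hn1 h0
  have hgrowth : growth ‖μ i‖ q n ≠ 0 :=
    mul_ne_zero (pow_ne_zero q (Nat.cast_ne_zero.2 (Nat.one_le_iff_ne_zero.1 hn1)))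
      (pow_ne_zero n (norm_ne_zero_iff.2 hμi))
  rw [← ContinuousLinearMap.toLinearMap_pow] at hn
  exact hgrowth (hn.1 h0)

variable [Finite ι]

theorem IsJordanBasis.tendsto_smul_pow_apply (hT : IsJordanBasis T.toLinearMap μ b)
    (hμ : ∀ j, ‖μ j‖ ≤ ‖μ i‖) (hμi : μ i ≠ 0) (hql : q + l + 1 = s i)
    (hs : ∀ j ≠ i, ‖μ j‖ = ‖μ i‖ → s j ≤ q) (hx : ∀ m < l, coord b i m x = 0)
    (hxl : coord b i l x ≠ 0) :
    Tendsto (fun n => (coord b i (q + l) ((T ^ n) x))⁻¹ • (T ^ n) x) atTop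
      (𝓝 (b ⟨i, ⟨q + l, by omega⟩⟩)) := by
  classical
  refine tendsto_of_tendsto_coord (b := b) fun j k hk => ?_
  simp only [map_smul, smul_eq_mul, coord_basis, inv_mul_eq_div]
  split_ifs with h
  · obtain ⟨rfl, rfl⟩ := h
    refine tendsto_const_nhds.congr' ?_
    filter_upwards [hT.eventually_coord_pow_ne_zero hμi hk hx hxl] with n hn
    exact (div_self hn).symm
  · have hnum : (fun n => coord b j k ((T.toLinearMap ^ n) x)) =o[atTop] growth ‖μ i‖ q := by
      by_cases hji : j = i
      · subst hji
        have hkne : q + l ≠ k := fun hkl => h ⟨rfl, hkl⟩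
        exact hT.coord_pow_isLittleO le_rfl hx fun _ => by omega
      · exact hT.coord_pow_isLittleO (l := 0) (hμ j) (by simp) fun hr =>
          hk.trans_le (hs j hji hr)
    have hdiv := (hnum.trans_isTheta
      (hT.coord_pow_isTheta (by omega) hx hxl).symm).tendsto_div_nhds_zero
    simpa only [← ContinuousLinearMap.toLinearMap_pow, ContinuousLinearMap.coe_coe] using hdiv

theorem IsJordanBasis.basis_last_mem_closure_orbAt (hT : IsJordanBasis T.toLinearMap μ b)
    (hμ : ∀ j, ‖μ j‖ ≤ ‖μ i‖) (hμi : μ i ≠ 0) {p : ℕ} (hp : p + 2 = s i)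
    (hs : ∀ j ≠ i, ‖μ j‖ = ‖μ i‖ → s j ≤ p) (hx : coord b i 1 x ≠ 0) :
    b ⟨i, ⟨p + 1, by omega⟩⟩ ∈ closure (orbAt T x) := by
  by_cases hx0 : coord b i 0 x = 0
  · exact mem_closure_of_tendsto
      (hT.tendsto_smul_pow_apply (q := p) (l := 1) hμ hμi hp hs (by simpa) hx)
      (.of_forall fun n => ⟨_, n, rfl⟩)
  · exact mem_closure_of_tendsto
      (hT.tendsto_smul_pow_apply (q := p + 1) (l := 0) hμ hμi hp
        (fun j hji hj => (hs j hji hj).trans p.le_succ) (by simp) hx0)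
      (.of_forall fun n => ⟨_, n, rfl⟩)

theorem IsJordanBasis.not_isOrbitReflexive (hT : IsJordanBasis T.toLinearMap μ b)
    (hμ : ∀ j, ‖μ j‖ ≤ ‖μ i‖) (hμi : μ i ≠ 0) (hsi : 1 < s i)
    (hs : ∀ j ≠ i, ‖μ j‖ = ‖μ i‖ → s j + 1 < s i) : ¬ IsOrbitReflexive T := by
  classical
  obtain ⟨p, hp⟩ := Nat.exists_eq_add_of_le' hsi
  set e : V := b ⟨i, ⟨p + 1, by omega⟩⟩
  let S : V →L[ℂ] V := (⟨coord b i 1, continuous_coord b i 1⟩ : V →L[ℂ] ℂ).smulRight e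
  have hSx (x : V) : S x = coord b i 1 x • e := rfl
  have hS : S ∈ orbRef T := fun x => by
    by_cases hx : coord b i 1 x = 0
    · exact subset_closure ⟨0, 0, by rw [hSx, hx, zero_smul, zero_smul]⟩
    · exact smul_mem_closure_orbAt _ (hT.basis_last_mem_closure_orbAt hμ hμi hp.symm
        (fun j hji hj => by have := hs j hji hj; omega) hx)
  intro hrefl
  set a : V := b ⟨i, ⟨0, by omega⟩⟩ with ha
  have ha1 : coord b i 1 a = 0 := by simp [ha, coord_basis]
  have hTa1 : coord b i 1 (T a) = 1 := by
    have h := hT.coord_succ_apply (k := 0) hsi a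
    rwa [ContinuousLinearMap.coe_coe, zero_add, ha1, mul_zero, zero_add, ha,
      coord_basis_self i ⟨0, by omega⟩] at h
  have hcomm := apply_comm_of_mem_sotClosure_orb (hrefl ▸ hS) a
  rw [hSx, hSx, hTa1, ha1, one_smul, zero_smul, map_zero] at hcomm
  exact b.ne_zero _ hcomm

theorem IsLeadingBlock.isOrbitReflexive_iff (hi : IsLeadingBlock μ s i)
    (hT : IsJordanBasis T.toLinearMap μ b) (hT' : ¬ IsNilpotent T) (hsi : 0 < s i) :
    IsOrbitReflexive T ↔ s i ≤ 1 ∨ ∃ j ≠ i, ‖μ j‖ = ‖μ i‖ ∧ s i ≤ s j + 1 := by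
  refine ⟨fun hrefl => ?_, hi.isOrbitReflexive hT hT' hsi⟩
  by_contra! h
  exact hT.not_isOrbitReflexive hi.norm_le (hi.eigenvalue_ne_zero hT hT') h.1 h.2 hrefl

theorem IsLeadingBlock.twoLargestDifferByAtMostOne_iff {J : JordanBlocks} {i : Fin J.numBlocks}
    (hi : IsLeadingBlock J.eigenvalue J.size i) :
    J.TwoLargestDifferByAtMostOne ‖J.eigenvalue i‖ₑ ↔ J.size i ≤ 1 ∨
      ∃ j ≠ i, ‖J.eigenvalue j‖ = ‖J.eigenvalue i‖ ∧ J.size i ≤ J.size j + 1 := by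
  classical
  have hmem {j : Fin J.numBlocks} :
      j ∈ J.ofModulus ‖J.eigenvalue i‖ₑ ↔ ‖J.eigenvalue j‖ = ‖J.eigenvalue i‖ := by
    simp [JordanBlocks.ofModulus, enorm_eq_iff_norm_eq]
  constructor
  · rintro ⟨m, hm, hmax, hsup⟩
    have hmi : J.size m = J.size i := (hi.size_le m (hmem.1 hm)).antisymm (hmax i (hmem.2 rfl))
    rcases le_or_gt (J.size i) 1 with h1 | h1
    · exact .inl h1
    obtain ⟨j, hj, hmj⟩ := (Finset.le_sup_iff (a := J.size m - 1)
      (bot_lt_iff_ne_bot.2 (Nat.sub_ne_zero_of_lt (hmi ▸ h1)))).1 (Nat.sub_le_of_le_add hsup)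
    obtain ⟨hjm, hj⟩ := Finset.mem_erase.1 hj
    by_cases hji : j = i
    · exact .inr ⟨m, hji ▸ hjm.symm, hmem.1 hm, hmi ▸ Nat.le_succ _⟩
    · exact .inr ⟨j, hji, hmem.1 hj, hmi ▸ Nat.sub_le_iff_le_add.1 hmj⟩
  · intro h
    refine ⟨i, hmem.2 rfl, fun j hj => hi.size_le j (hmem.1 hj), ?_⟩
    rcases h with h | ⟨j, hji, hj, hij⟩
    · exact h.trans (Nat.le_add_left _ _)
    · refine hij.trans (Nat.add_le_add_right ?_ 1)
      exact Finset.le_sup (Finset.mem_erase.2 ⟨hji, hmem.2 hj⟩)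

theorem IsLeadingBlock.spectralRadius_eq (hi : IsLeadingBlock μ s i)
    (hT : IsJordanBasis T.toLinearMap μ b) (hs : ∀ j, 0 < s j) :
    spectralRadius ℂ T = ‖μ i‖ₑ := by
  have := b.finiteDimensional_of_finite
  have hspec {z : ℂ} : z ∈ spectrum ℂ T ↔ ∃ j, μ j = z := by
    rw [← hT.hasEigenvalue_iff hs, Module.End.hasEigenvalue_iff_mem_spectrum,
      ← AlgEquiv.spectrum_eq (Module.End.toContinuousLinearMap V)]
    rfl
  refine le_antisymm (iSup₂_le fun z hz => ?_) (le_iSup₂_of_le (μ i) (hspec.2 ⟨i, rfl⟩) le_rfl)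
  obtain ⟨j, rfl⟩ := hspec.1 hz
  exact ENNReal.coe_le_coe.2 (hi.norm_le j)

theorem HasJordanForm.exists_isLeadingBlock {J : JordanBlocks} (hJ : HasJordanForm T.toLinearMap J)
    (hT : ¬ IsNilpotent T) : ∃ i, IsLeadingBlock J.eigenvalue J.size i := by
  obtain ⟨b, hb⟩ := hJ
  have : Nonempty (Fin J.numBlocks) := by
    by_contra! hempty
    exact hT (hb.isNilpotent_of_toLinearMap isEmptyElim)
  exact COrbit.exists_isLeadingBlock _ _

end Characterization

end COrbit

theorem mainTheorem1_general {V : Type*} [NormedAddCommGroup V] [NormedSpace ℂ V]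
    [FiniteDimensional ℂ V] (T : V →L[ℂ] V) (hT : ¬ IsNilpotent T) :
    0 < spectralRadius ℂ T ∧
    (∃ J : COrbit.JordanBlocks, COrbit.HasJordanForm T.toLinearMap J) ∧
    ∀ J : COrbit.JordanBlocks, COrbit.HasJordanForm T.toLinearMap J →
      (COrbit.IsOrbitReflexive T ↔ J.TwoLargestDifferByAtMostOne (spectralRadius ℂ T)) := by
  obtain ⟨J₀, hJ₀⟩ := COrbit.exists_hasJordanForm T.toLinearMap
  refine ⟨?_, ⟨J₀, hJ₀⟩, fun J hJ => ?_⟩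
  · obtain ⟨i, hi⟩ := hJ₀.exists_isLeadingBlock hT
    obtain ⟨b, hb⟩ := hJ₀
    rw [hi.spectralRadius_eq hb J₀.size_pos]
    exact enorm_pos.2 (hi.eigenvalue_ne_zero hb hT)
  · obtain ⟨i, hi⟩ := hJ.exists_isLeadingBlock hT
    obtain ⟨b, hb⟩ := hJ
    rw [hi.spectralRadius_eq hb J.size_pos, hi.twoLargestDifferByAtMostOne_iff,
      hi.isOrbitReflexive_iff hb hT (J.size_pos i)]

theorem mainTheorem1 (d : ℕ) (T : Matrix (Fin d) (Fin d) ℂ) (hT : ¬ IsNilpotent T) :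
    0 < spectralRadius ℂ T ∧
    (∃ J : COrbit.JordanBlocks, COrbit.IsJordanForm T J) ∧
    ∀ J : COrbit.JordanBlocks, COrbit.IsJordanForm T J →
      (COrbit.IsOrbitReflexive (Matrix.toEuclideanCLM (𝕜 := ℂ) T) ↔
        J.TwoLargestDifferByAtMostOne (spectralRadius ℂ T)) := by
  have hr : spectralRadius ℂ (Matrix.toEuclideanCLM (𝕜 := ℂ) T) = spectralRadius ℂ T := by
    simp only [spectralRadius, AlgEquiv.spectrum_eq]
  have hT' : ¬ IsNilpotent (Matrix.toEuclideanCLM (𝕜 := ℂ) T) := fun h =>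
    hT (by simpa using h.map (Matrix.toEuclideanCLM (𝕜 := ℂ) (n := Fin d)).symm)
  simpa only [hr, ← COrbit.isJordanForm_iff] using
    mainTheorem1_general (Matrix.toEuclideanCLM (𝕜 := ℂ) T) hT'
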